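/- For a real number $x$ let $\|x\|$ be its distance to the nearest integer, and put $\chi(x)=+1$ if $x-\lfloor x\rfloor<\frac12$ and $\chi(x)=-1$ otherwise. For $t>0$, a vector $(\gamma_1,\dots,\gamma_s)\in\mathbb{R}^s$ is said to be of finite type $t$ if for every $\varepsilon>0$ there is a constant $c=c(\varepsilon,\gamma_1,\dots,\gamma_s)>0$ such that $$\prod_{j=1}^s \max(1,|n_j|)^{t+\varepsilon}\,\Big\|\sum_{j=1}^s n_j\gamma_j\Big\|\ \ge\ c\qquad\text{for all }(n_1,\dots,n_s)\in\mathbb{Z}^s\setminus\{0\}.$$ For a finite sequence $E_N=(e_n)_{n=1}^N\in\{-1,+1\}^N$ the well-distribution measure is $$W(E_N)=\max_{a,b,M}\Big|\sum_{m=1}^M e_{am+b}\Big|,$$ where the maximum is over all integers $a\ge1$, $b\in\mathbb{Z}$, $M\ge1$ with $1\le a+b<aM+b\le N$ (and $W(E_1)=0$, since for $N=1$ there are no such triples). **Theorem.** Let $\alpha_1,\alpha_2,\beta$ be real numbers, let $p\in\mathbb{R}[x]$ be a monic polynomial of degree $d\ge2$, and let $$f(x)=\beta\big\lfloor\alpha_1\lfloor\alpha_2\,p(x)\rfloor\big\rfloor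 .$$ For $N\ge1$ let $E_N=(e_n)_{n=1}^N$ with $e_n=\chi(f(n))$. Let $t>0$ and suppose that $(\alpha_2,\ \alpha_1\alpha_2,\ \alpha_1\alpha_2\beta)$ is of finite type $t$. Then there exists $\eta=\eta(f,t)>0$, depending only on $f$ and $t$, such that for every $\varepsilon>0$ there is a constant $C=C(f,t,\varepsilon)>0$ with $$W(E_N)\le C\,N^{1-\eta+\varepsilon}\qquad\text{for all integers }N\ge1 .$$ -/

import Mathlib

/-- The distance `‖x‖` of a real number to the nearest integer. -/
noncomputable def distNearestInt (x : ℝ) : ℝ := |x - (round x : ℝ)|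

/-- `(γ₁, …, γ_s)` is of finite type `t`: for every `ε > 0` there is `c > 0` such that
`∏ max(1, |n_j|)^(t + ε) * ‖∑ n_j γ_j‖ ≥ c` for all nonzero integer vectors `n`. -/
def IsOfFiniteType {s : ℕ} (γ : Fin s → ℝ) (t : ℝ) : Prop :=
  ∀ ε : ℝ, 0 < ε → ∃ c : ℝ, 0 < c ∧ ∀ n : Fin s → ℤ, n ≠ 0 →
    c ≤ (∏ j, (max 1 |(n j : ℝ)|) ^ (t + ε)) * distNearestInt (∑ j, (n j : ℝ) * γ j)

/-- The sign `χ(x)`: `+1` if the fractional part of `x` is less than `1/2`, and `-1` otherwise. -/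
noncomputable def chiSign (x : ℝ) : ℤ := if x - (⌊x⌋ : ℝ) < 1 / 2 then 1 else -1

/-- The generalized polynomial `f(x) = β ⌊α₁ ⌊α₂ p(x)⌋⌋`. -/
noncomputable def genPoly (α₁ α₂ β : ℝ) (p : Polynomial ℝ) (x : ℝ) : ℝ :=
  β * (⌊α₁ * (⌊α₂ * p.eval x⌋ : ℝ)⌋ : ℝ)

/-- The binary sequence `e_n = χ(f(n))` induced by a real function `f`. -/
noncomputable def inducedSeq (f : ℝ → ℝ) (n : ℤ) : ℤ := chiSign (f (n : ℝ))

/-- The sum `∑_{m=1}^M e_{am+b}` along an arithmetic progression. -/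
def progressionSum (e : ℤ → ℤ) (M a : ℕ) (b : ℤ) : ℤ :=
  ∑ m ∈ Finset.Icc 1 M, e ((a : ℤ) * (m : ℤ) + b)

/-- The values `|∑_{m=1}^M e_{am+b}|` for integers `a ≥ 1`, `b`, `M ≥ 1` with
`1 ≤ a + b < aM + b ≤ N`. Only the terms `e_1, …, e_N` enter. -/
def progressionValues (e : ℤ → ℤ) (N : ℕ) : Set ℝ :=
  {x | ∃ (a : ℕ) (b : ℤ) (M : ℕ), 1 ≤ a ∧ 1 ≤ M ∧
    1 ≤ (a : ℤ) + b ∧ (a : ℤ) + b < (a : ℤ) * (M : ℤ) + b ∧ (a : ℤ) * (M : ℤ) + b ≤ (N : ℤ) ∧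
    x = |(progressionSum e M a b : ℝ)|}

/-- The well-distribution measure `W(E_N)` of `E_N = (e_1, …, e_N)`: the maximum of the values
above (with value `0` if `N ≤ 1`, where no triple `(a, b, M)` is admissible). -/
noncomputable def wellDistribution (e : ℤ → ℤ) (N : ℕ) : ℝ := sSup (progressionValues e N)

/-- For a binary sequence all the values are at most `N`, so the supremum is a genuine one. -/
theorem le_of_mem_progressionValues {e : ℤ → ℤ} (he : ∀ n, |e n| ≤ 1) {N : ℕ} {x : ℝ}
    (hx : x ∈ progressionValues e N) : x ≤ N := by
  obtain ⟨a, b, M, ha, hM, h1, -, h3, rfl⟩ := hx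
  have hs : |progressionSum e M a b| ≤ (M : ℤ) := by
    refine (Finset.abs_sum_le_sum_abs _ _).trans ?_
    refine (Finset.sum_le_sum fun m _ => he _).trans ?_
    simp
  have hMN : (M : ℤ) ≤ N := by
    have ha' : (1 : ℤ) ≤ a := by exact_mod_cast ha
    have hM' : (1 : ℤ) ≤ M := by exact_mod_cast hM
    nlinarith [mul_nonneg (sub_nonneg.2 ha') (sub_nonneg.2 hM')]
  exact_mod_cast hs.trans hMN

/-!
Put `u = α₂ p`. Since `⌊α₁ ⌊u⌋⌋ = ⌊α₁ u - α₁ {u}⌋`, the sign `χ(f(n))` is a piecewise constant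
function `F` on the torus `ℝ³ / ℤ³`, evaluated at `(α₂, α₁ α₂, α₁ α₂ β) p(n)`. The torus average
of `F` vanishes because `χ(x + 1/2) = -χ(x)`.

Along a progression, every nontrivial character of this point is `e(θ q(m))` with `q` a polynomial
of degree `d` and `θ` a nonzero integer combination of `α₂, α₁ α₂, α₁ α₂ β`; finite type keeps the
leading coefficient away from the rationals, so Weyl differencing gives a power saving. To pass
from characters to the discontinuous `F`, weight the sum by a product of Fejér kernels centred at
the points of a grid: these weights add up to a constant, are trigonometric polynomials, and
concentrate near their centres, so `F` is replaced by its values on the grid, except at the few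
grid points close to a discontinuity. A power saving in every progression of small difference
gives the bound for the well-distribution measure, since progressions of large difference are
short.
-/

open Finset Polynomial
open scoped ComplexConjugate FourierTransform

/-! ### Distance to the nearest integer and additive characters -/

theorem distNearestInt_nonneg (x : ℝ) : 0 ≤ distNearestInt x := abs_nonneg _

theorem distNearestInt_le_abs_sub_intCast (x : ℝ) (n : ℤ) : distNearestInt x ≤ |x - n| :=
  round_le x n

theorem exists_eq_add_add_intCast (x y : ℝ) :
    ∃ (s : ℝ) (n : ℤ), x = y + s + n ∧ |s| = distNearestInt (x - y) :=
  ⟨x - y - round (x - y), round (x - y), by ring, rfl⟩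

theorem floor_add_eq_of_abs_lt_distNearestInt {y s : ℝ} (h : |s| < distNearestInt y) :
    ⌊y + s⌋ = ⌊y⌋ := by
  have h_below := distNearestInt_le_abs_sub_intCast y ⌊y⌋
  have h_above := distNearestInt_le_abs_sub_intCast y (⌊y⌋ + 1)
  rw [abs_of_nonneg (sub_nonneg.2 (Int.floor_le y))] at h_below
  push_cast at h_above
  rw [abs_of_neg (sub_neg.2 (Int.lt_floor_add_one y))] at h_above
  obtain ⟨h_neg, h_pos⟩ := abs_lt.1 h
  rw [Int.floor_eq_iff]
  constructor <;> linarith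

theorem fract_add_eq_of_abs_lt_distNearestInt {y s : ℝ} (h : |s| < distNearestInt y) :
    Int.fract (y + s) = Int.fract y + s := by
  rw [Int.fract, Int.fract, floor_add_eq_of_abs_lt_distNearestInt h, add_sub_right_comm]

theorem fourierChar_eq_one_iff {x : ℝ} : 𝐞 x = 1 ↔ ∃ n : ℤ, x = n := by
  rw [Real.fourierChar_apply', Circle.exp_eq_one]
  refine exists_congr fun n => ?_
  rw [mul_comm, mul_left_inj' Real.two_pi_pos.ne']

theorem four_mul_distNearestInt_le_norm_fourierChar_sub_one (x : ℝ) :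
    4 * distNearestInt x ≤ ‖(𝐞 x : ℂ) - 1‖ := by
  have h_periodic : 𝐞 x = 𝐞 (x - round x) := by
    rw [AddChar.map_sub_eq_div, fourierChar_eq_one_iff.2 ⟨_, rfl⟩, div_one]
  have h_mem : |x - round x| ≤ 1 / 2 := abs_sub_round x
  rw [h_periodic, distNearestInt]
  generalize x - round x = y at h_mem
  have h_chord : ‖(𝐞 y : ℂ) - 1‖ = 2 * |Real.sin (Real.pi * y)| := by
    rw [Real.fourierChar_apply, mul_comm _ Complex.I, Complex.norm_exp_I_mul_ofReal_sub_one,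
      norm_mul, Real.norm_ofNat, Real.norm_eq_abs, mul_assoc, mul_div_cancel_left₀ _ two_ne_zero]
  have h_abs : |Real.pi * y| = Real.pi * |y| := by rw [abs_mul, abs_of_pos Real.pi_pos]
  have h_jordan := Real.mul_abs_le_abs_sin (x := Real.pi * y)
    (by rw [h_abs]; nlinarith [Real.pi_pos])
  have h_cancel : 2 / Real.pi * (Real.pi * |y|) = 2 * |y| := by field_simp
  rw [h_abs, h_cancel] at h_jordan
  linarith

theorem sum_fourierChar_mul_sub_one (L : ℕ) (x : ℝ) :
    (∑ n ∈ range L, (𝐞 (n * x) : ℂ)) * (𝐞 x - 1) = 𝐞 (L * x) - 1 := by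
  simp_rw [← nsmul_eq_mul, AddChar.map_nsmul_eq_pow, Circle.coe_pow]
  exact geom_sum_mul _ _

theorem norm_sum_fourierChar_mul_distNearestInt_le (L : ℕ) (x : ℝ) :
    ‖∑ n ∈ range L, (𝐞 (n * x) : ℂ)‖ * distNearestInt x ≤ 1 := by
  have h_prod : ‖∑ n ∈ range L, (𝐞 (n * x) : ℂ)‖ * ‖(𝐞 x : ℂ) - 1‖ ≤ 2 := by
    rw [← norm_mul, sum_fourierChar_mul_sub_one]
    refine (norm_sub_le _ _).trans_eq ?_
    rw [Circle.norm_coe, norm_one, one_add_one_eq_two]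
  have h_dist := mul_le_mul_of_nonneg_left (four_mul_distNearestInt_le_norm_fourierChar_sub_one x)
    (norm_nonneg (∑ n ∈ range L, (𝐞 (n * x) : ℂ)))
  linarith

theorem fourierChar_sum {ι : Type*} (s : Finset ι) (x : ι → ℝ) :
    (𝐞 (∑ i ∈ s, x i) : ℂ) = ∏ i ∈ s, (𝐞 (x i) : ℂ) :=
  map_prod (Circle.coeHom.comp (𝐞).toMonoidHom) (fun i => Multiplicative.ofAdd (x i)) s

theorem fourierChar_mul_conj_fourierChar (x y : ℝ) : (𝐞 x : ℂ) * conj (𝐞 y : ℂ) = 𝐞 (x - y) := by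
  rw [AddChar.map_sub_eq_div, div_eq_mul_inv, Circle.coe_mul, Circle.coe_inv_eq_conj]

theorem ofReal_norm_sum_sq {ι : Type*} (s : Finset ι) (f : ι → ℂ) :
    ((‖∑ i ∈ s, f i‖ ^ 2 : ℝ) : ℂ) = ∑ i ∈ s, ∑ j ∈ s, f i * conj (f j) := by
  rw [Complex.ofReal_pow, ← Complex.mul_conj', map_sum, sum_mul_sum]

/-! ### Van der Corput's inequality -/

theorem norm_sum_range_sub_sum_range_add_le {z : ℕ → ℂ} (hz : ∀ n, ‖z n‖ ≤ 1) (L k : ℕ) :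
    ‖∑ n ∈ range L, z n - ∑ n ∈ range L, z (n + k)‖ ≤ 2 * k := by
  have h_block : ∀ m, ‖∑ n ∈ range k, z (m + n)‖ ≤ k := fun m =>
    (norm_sum_le_of_le _ fun n _ => hz (m + n)).trans_eq (by simp)
  have h_boundary : ∑ n ∈ range L, z n - ∑ n ∈ range L, z (n + k)
      = ∑ n ∈ range k, z (0 + n) - ∑ n ∈ range k, z (L + n) := by
    have h_split := (sum_range_add z L k).symm.trans ((add_comm L k) ▸ sum_range_add z k L)
    simp only [zero_add, add_comm _ k]
    linear_combination h_split
  rw [h_boundary, two_mul]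
  exact norm_sub_le_of_le (h_block 0) (h_block L)

theorem norm_mul_sum_sub_sum_window_le {z : ℕ → ℂ} (hz : ∀ n, ‖z n‖ ≤ 1) (L H : ℕ) :
    ‖H * ∑ n ∈ range L, z n - ∑ n ∈ range L, ∑ k ∈ range H, z (n + k)‖ ≤ H * (2 * H) := by
  have h_eq : H * ∑ n ∈ range L, z n - ∑ n ∈ range L, ∑ k ∈ range H, z (n + k)
      = ∑ k ∈ range H, (∑ n ∈ range L, z n - ∑ n ∈ range L, z (n + k)) := by
    rw [sum_comm, sum_sub_distrib, sum_const, card_range, nsmul_eq_mul]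
  rw [h_eq]
  refine (norm_sum_le_of_le _ fun k hk => ?_).trans_eq
    (by rw [sum_const, card_range, nsmul_eq_mul] : ∑ _k ∈ range H, (2 * H : ℝ) = H * (2 * H))
  have hkH : (k : ℝ) ≤ H := by exact_mod_cast (mem_range.1 hk).le
  linarith [norm_sum_range_sub_sum_range_add_le hz L k]

section VanDerCorput

variable {z : ℕ → ℂ} {L H : ℕ} {B : ℝ}

theorem sum_norm_sq_window_le (hz : ∀ n, ‖z n‖ ≤ 1) (hB₀ : 0 ≤ B)
    (hB : ∀ k < H, ∀ l < H, k ≠ l → ‖∑ n ∈ range L, z (n + k) * conj (z (n + l))‖ ≤ B) :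
    ∑ n ∈ range L, ‖∑ k ∈ range H, z (n + k)‖ ^ 2 ≤ H * L + H ^ 2 * B := by
  have h_corr : ∀ k ∈ range H, ∀ l ∈ range H,
      ‖∑ n ∈ range L, z (n + k) * conj (z (n + l))‖ ≤ (if k = l then (L : ℝ) else 0) + B := by
    intro k hk l hl
    split_ifs with hkl
    · have h_term : ∀ n, ‖z (n + k) * conj (z (n + l))‖ ≤ 1 := fun n => by
        rw [norm_mul, RCLike.norm_conj]
        exact mul_le_one₀ (hz _) (norm_nonneg _) (hz _)
      have h_diag := norm_sum_le_of_le (range L) fun n _ => h_term n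
      rw [sum_const, card_range, nsmul_eq_mul, mul_one] at h_diag
      linarith
    · rw [zero_add]
      exact hB k (mem_range.1 hk) l (mem_range.1 hl) hkl
  have h_expand : ((∑ n ∈ range L, ‖∑ k ∈ range H, z (n + k)‖ ^ 2 : ℝ) : ℂ)
      = ∑ k ∈ range H, ∑ l ∈ range H, ∑ n ∈ range L, z (n + k) * conj (z (n + l)) := by
    simp_rw [Complex.ofReal_sum, ofReal_norm_sum_sq]
    rw [sum_comm]
    exact sum_congr rfl fun k _ => sum_comm
  calc ∑ n ∈ range L, ‖∑ k ∈ range H, z (n + k)‖ ^ 2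
      = ‖((∑ n ∈ range L, ‖∑ k ∈ range H, z (n + k)‖ ^ 2 : ℝ) : ℂ)‖ := by
        rw [Complex.norm_real, Real.norm_of_nonneg (by positivity)]
    _ ≤ ∑ k ∈ range H, ∑ l ∈ range H, ((if k = l then (L : ℝ) else 0) + B) := by
        rw [h_expand]
        exact norm_sum_le_of_le _ fun k hk => norm_sum_le_of_le _ fun l hl => h_corr k hk l hl
    _ = H * L + H ^ 2 * B := by
        simp only [sum_add_distrib, sum_ite_eq, sum_ite_mem, inter_self, sum_const, card_range,
          nsmul_eq_mul]
        ring

theorem norm_sum_le_of_norm_correlation_le (hz : ∀ n, ‖z n‖ ≤ 1) (hH : 0 < H) (hB₀ : 0 ≤ B)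
    (hB : ∀ k < H, ∀ l < H, k ≠ l → ‖∑ n ∈ range L, z (n + k) * conj (z (n + l))‖ ≤ B) :
    ‖∑ n ∈ range L, z n‖ ≤ 2 * H + √(L * (L / H + B)) := by
  have hH' : (0 : ℝ) < H := by exact_mod_cast hH
  set T : ℂ := ∑ n ∈ range L, ∑ k ∈ range H, z (n + k)
  have h_cauchy : ‖T‖ ^ 2 ≤ L * (H * L + H ^ 2 * B) :=
    calc ‖T‖ ^ 2 ≤ (∑ n ∈ range L, ‖∑ k ∈ range H, z (n + k)‖) ^ 2 := by
          gcongr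
          exact norm_sum_le _ _
      _ ≤ L * ∑ n ∈ range L, ‖∑ k ∈ range H, z (n + k)‖ ^ 2 := by
          simpa only [card_range] using sq_sum_le_card_mul_sum_sq
            (s := range L) (f := fun n => ‖∑ k ∈ range H, z (n + k)‖)
      _ ≤ L * (H * L + H ^ 2 * B) := by
          gcongr
          exact sum_norm_sq_window_le hz hB₀ hB
  have h_window : ‖T‖ ≤ H * √(L * (L / H + B)) := by
    refine le_of_sq_le_sq (h_cauchy.trans_eq ?_) (by positivity)
    rw [mul_pow, Real.sq_sqrt (by positivity)]
    field_simp
  have h_scaled : H * ‖∑ n ∈ range L, z n‖ ≤ H * (2 * H + √(L * (L / H + B))) :=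
    calc H * ‖∑ n ∈ range L, z n‖ = ‖H * ∑ n ∈ range L, z n‖ := by
          rw [norm_mul, Complex.norm_natCast]
      _ ≤ ‖H * ∑ n ∈ range L, z n - T‖ + ‖T‖ := norm_le_norm_sub_add _ _
      _ ≤ H * (2 * H) + H * √(L * (L / H + B)) :=
          add_le_add (norm_mul_sum_sub_sum_window_le hz L H) h_window
      _ = H * (2 * H + √(L * (L / H + B))) := (mul_add _ _ _).symm
  exact le_of_mul_le_mul_left h_scaled hH'

end VanDerCorput

/-! ### Weyl sums -/

/-- Weyl's Diophantine condition on a leading coefficient `θ`: every multiple `nθ` with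
`0 < |n| ≤ Q` has distance at least `1 / X` from the integers. The product form avoids `1 / 0`. -/
def IsIrrationalUpTo (θ Q X : ℝ) : Prop :=
  ∀ n : ℤ, n ≠ 0 → |(n : ℝ)| ≤ Q → 1 ≤ X * distNearestInt (n * θ)

theorem IsIrrationalUpTo.intCast_mul {θ Q P X : ℝ} (hθ : IsIrrationalUpTo θ (Q * P) X) {k : ℤ}
    (hk : k ≠ 0) (hkP : |(k : ℝ)| ≤ P) : IsIrrationalUpTo (k * θ) Q X := by
  intro n hn hnQ
  have h := hθ (n * k) (mul_ne_zero hn hk) (by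
    push_cast
    rw [abs_mul]
    exact mul_le_mul hnQ hkP (abs_nonneg _) ((abs_nonneg _).trans hnQ))
  rwa [Int.cast_mul, mul_assoc] at h

theorem coeff_taylor_of_natDegree_le_succ {R : Type*} [CommRing R] {q : R[X]} {d : ℕ}
    (hq : q.natDegree ≤ d + 1) (x : R) :
    (taylor x q).coeff d = (d + 1) * q.coeff (d + 1) * x + q.coeff d := by
  have h_linear : (hasseDeriv d q).natDegree ≤ 1 :=
    (natDegree_hasseDeriv_le q d).trans (by omega)
  rw [taylor_coeff, eq_X_add_C_of_natDegree_le_one h_linear]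
  simp [hasseDeriv_coeff, add_comm 1 d]

theorem coeff_taylor_of_natDegree_le {R : Type*} [CommRing R] {q : R[X]} {d : ℕ}
    (hq : q.natDegree ≤ d) (x : R) : (taylor x q).coeff d = q.coeff d := by
  have h_const : (hasseDeriv d q).natDegree ≤ 0 :=
    (natDegree_hasseDeriv_le q d).trans (by omega)
  rw [taylor_coeff, eq_C_of_natDegree_le_zero h_const]
  simp [hasseDeriv_coeff]

theorem natDegree_taylor_sub_taylor_le {R : Type*} [CommRing R] {q : R[X]} {d : ℕ}
    (hq : q.natDegree ≤ d + 1) (x y : R) : (taylor x q - taylor y q).natDegree ≤ d := by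
  have h_le : (taylor x q - taylor y q).natDegree ≤ d + 1 :=
    (natDegree_sub_le _ _).trans (by rw [natDegree_taylor, natDegree_taylor, max_self]; exact hq)
  refine natDegree_le_pred h_le ?_
  rw [coeff_sub, coeff_taylor_of_natDegree_le hq, coeff_taylor_of_natDegree_le hq, sub_self]

theorem coeff_taylor_sub_taylor {R : Type*} [CommRing R] {q : R[X]} {d : ℕ}
    (hq : q.natDegree ≤ d + 1) (x y : R) :
    (taylor x q - taylor y q).coeff d = (d + 1) * (x - y) * q.coeff (d + 1) := by
  rw [coeff_sub, coeff_taylor_of_natDegree_le_succ hq, coeff_taylor_of_natDegree_le_succ hq]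
  ring

theorem norm_sum_fourierChar_eval_mul_distNearestInt_le {q : ℝ[X]} (hq : q.natDegree ≤ 1)
    (L : ℕ) :
    ‖∑ n ∈ range L, (𝐞 (q.eval (n : ℝ)) : ℂ)‖ * distNearestInt (q.coeff 1) ≤ 1 := by
  have h_factor : ∑ n ∈ range L, (𝐞 (q.eval (n : ℝ)) : ℂ)
      = 𝐞 (q.coeff 0) * ∑ n ∈ range L, (𝐞 (n * q.coeff 1) : ℂ) := by
    rw [mul_sum]
    refine sum_congr rfl fun n _ => ?_
    rw [← Circle.coe_mul, ← AddChar.map_add_eq_mul]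
    nth_rw 1 [eq_X_add_C_of_natDegree_le_one hq]
    rw [eval_add, eval_mul, eval_C, eval_X, eval_C, add_comm, mul_comm]
  rw [h_factor, norm_mul, Circle.norm_coe, one_mul]
  exact norm_sum_fourierChar_mul_distNearestInt_le L _

theorem fourierChar_eval_add_mul_conj (q : ℝ[X]) (n k l : ℕ) :
    (𝐞 (q.eval ((n + k : ℕ) : ℝ)) : ℂ) * conj (𝐞 (q.eval ((n + l : ℕ) : ℝ)) : ℂ)
      = 𝐞 ((taylor (k : ℝ) q - taylor (l : ℝ) q).eval (n : ℝ)) := by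
  rw [fourierChar_mul_conj_fourierChar, eval_sub, taylor_eval, taylor_eval]
  push_cast
  rfl

theorem IsIrrationalUpTo.coeff_taylor_sub_taylor {q : ℝ[X]} {d H : ℕ} {X : ℝ}
    (hq : q.natDegree ≤ d + 2)
    (hθ : IsIrrationalUpTo (q.coeff (d + 2)) ((d + 2).factorial * H ^ (d + 1)) X)
    {k l : ℕ} (hk : k < H) (hl : l < H) (hkl : k ≠ l) :
    IsIrrationalUpTo ((taylor (k : ℝ) q - taylor (l : ℝ) q).coeff (d + 1))
      ((d + 1).factorial * H ^ d) X := by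
  have h_coeff : (taylor (k : ℝ) q - taylor (l : ℝ) q).coeff (d + 1)
      = (((d + 2) * ((k : ℤ) - l) : ℤ) : ℝ) * q.coeff (d + 2) := by
    rw [_root_.coeff_taylor_sub_taylor hq]
    push_cast
    ring
  have h_bound : ((d + 2).factorial * H ^ (d + 1) : ℝ)
      = (d + 1).factorial * H ^ d * ((d + 2) * H) := by
    rw [Nat.factorial_succ (d + 1)]
    push_cast
    ring
  have h_diff : |((k : ℤ) - l : ℤ)| ≤ H := by rw [abs_le]; omega
  rw [h_coeff]
  refine (h_bound ▸ hθ).intCast_mul (mul_ne_zero (by positivity) (by omega)) ?_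
  rw [Int.cast_mul, abs_mul, abs_of_nonneg (by positivity)]
  push_cast
  gcongr
  exact_mod_cast h_diff

theorem two_mul_add_sqrt_le {L H R M : ℝ} (hR : 1 ≤ R) (hRH : R ^ 2 ≤ H) (hHM : H ^ 2 ≤ M)
    (hL₀ : 0 ≤ L) (hLM : L ≤ M) : 2 * H + √(L * (L / H + 6 * M / R ^ 2)) ≤ 6 * M / R := by
  have hH : 0 < H := by nlinarith
  have hM : 0 ≤ M := hL₀.trans hLM
  have h_window : 2 * H ≤ 2 * (M / R) := by
    have hRH' : H * R ≤ H * H := by gcongr; nlinarith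
    have h_le : H ≤ M / R := by rw [le_div_iff₀ (by linarith)]; nlinarith
    linarith
  have h_sqrt : √(L * (L / H + 6 * M / R ^ 2)) ≤ 3 * (M / R) := by
    refine Real.sqrt_le_iff.2 ⟨by positivity, ?_⟩
    calc L * (L / H + 6 * M / R ^ 2) ≤ M * (M / R ^ 2 + 6 * M / R ^ 2) := by gcongr
      _ = 7 * (M / R) ^ 2 := by field_simp; ring
      _ ≤ (3 * (M / R)) ^ 2 := by nlinarith [sq_nonneg (M / R)]
  have h_assoc : 6 * M / R = 6 * (M / R) := mul_div_assoc _ _ _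
  linarith [(by positivity : 0 ≤ M / R)]

-- The window length `H = R ^ 2 ^ d` is kept through the whole induction: differencing lowers `d` by
-- one and replaces the saving `R` by `R ^ 2`.
theorem norm_sum_fourierChar_eval_le {d R H L : ℕ} {M X : ℝ} {q : ℝ[X]} (hR : 0 < R)
    (hH : R ^ 2 ^ d = H) (hHM : (H : ℝ) ^ 2 ≤ M) (hXM : X * H ≤ M) (hLM : L ≤ M)
    (hq : q.natDegree ≤ d + 1)
    (hθ : IsIrrationalUpTo (q.coeff (d + 1)) ((d + 1).factorial * H ^ d) X) :
    ‖∑ n ∈ range L, (𝐞 (q.eval (n : ℝ)) : ℂ)‖ ≤ 6 * M / R := by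
  have hM : 0 ≤ M := (Nat.cast_nonneg L).trans hLM
  induction d generalizing R q with
  | zero =>
    obtain rfl : R = H := by simpa using hH
    have hX : 1 ≤ X * distNearestInt (q.coeff 1) := by
      simpa using hθ 1 one_ne_zero (by simp)
    have h_linear := norm_sum_fourierChar_eval_mul_distNearestInt_le hq L
    have hX₀ : 0 < X := pos_of_mul_pos_left (one_pos.trans_le hX) (distNearestInt_nonneg _)
    set S := ‖∑ n ∈ range L, (𝐞 (q.eval (n : ℝ)) : ℂ)‖
    have h_sum : S ≤ X :=
      calc S ≤ S * (X * distNearestInt (q.coeff 1)) :=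
            le_mul_of_one_le_right (norm_nonneg _) hX
        _ = X * (S * distNearestInt (q.coeff 1)) := mul_left_comm _ _ _
        _ ≤ X := mul_le_of_le_one_right hX₀.le h_linear
    have hR' : (0 : ℝ) < R := by exact_mod_cast hR
    rw [le_div_iff₀ hR']
    nlinarith
  | succ d ih =>
    have hR' : (1 : ℝ) ≤ R := by exact_mod_cast hR
    have hH' : (R ^ 2) ^ 2 ^ d = H := by rw [← hH, ← pow_mul, pow_succ' 2 d]
    have hRH : R ^ 2 ≤ H := hH' ▸ Nat.le_self_pow (by positivity) _
    have h_corr : ∀ k < H, ∀ l < H, k ≠ l →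
        ‖∑ n ∈ range L, (𝐞 (q.eval ((n + k : ℕ) : ℝ)) : ℂ) *
          conj (𝐞 (q.eval ((n + l : ℕ) : ℝ)) : ℂ)‖ ≤ 6 * M / (R ^ 2 : ℕ) := by
      intro k hk l hl hkl
      simp_rw [fourierChar_eval_add_mul_conj]
      exact ih (by positivity) hH' (natDegree_taylor_sub_taylor_le hq _ _)
        (hθ.coeff_taylor_sub_taylor hq hk hl hkl)
    refine (norm_sum_le_of_norm_correlation_le (z := fun n => (𝐞 (q.eval (n : ℝ)) : ℂ))
      (fun n => (Circle.norm_coe _).le) ((by positivity : 0 < R ^ 2).trans_le hRH)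
      (by positivity) h_corr).trans ?_
    push_cast
    exact two_mul_add_sqrt_le hR' (by exact_mod_cast hRH) hHM (Nat.cast_nonneg L) hLM

/-! ### The Fejér kernel on a grid -/

theorem sum_fourierChar_mul_sub_div {K : ℕ} (k l : Fin K) :
    ∑ j : Fin K, (𝐞 (j * ((k - l : ℝ) / K)) : ℂ) = if k = l then (K : ℂ) else 0 := by
  have hK : (K : ℝ) ≠ 0 := by exact_mod_cast (Fin.pos k).ne'
  split_ifs with hkl
  · simp [hkl]
  have h_period : 𝐞 (K * ((k - l : ℝ) / K)) = 1 :=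
    fourierChar_eq_one_iff.2 ⟨(k : ℤ) - l, by rw [mul_div_cancel₀ _ hK]; push_cast; rfl⟩
  have h_ne : (𝐞 ((k - l : ℝ) / K) : ℂ) ≠ 1 := by
    rw [Ne, Circle.coe_eq_one, fourierChar_eq_one_iff]
    rintro ⟨n, hn⟩
    rw [div_eq_iff hK] at hn
    have h_dvd : (K : ℤ) ∣ (k : ℤ) - l := Dvd.intro_left n (by exact_mod_cast hn.symm)
    have h_zero : (k : ℤ) - l = 0 := Int.eq_zero_of_abs_lt_dvd h_dvd (by rw [abs_lt]; omega)
    exact hkl (Fin.ext (by omega))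
  have h_geom := sum_fourierChar_mul_sub_one K ((k - l : ℝ) / K)
  rw [h_period, Circle.coe_one, sub_self] at h_geom
  rw [Fin.sum_univ_eq_sum_range (fun j => (𝐞 (j * ((k - l : ℝ) / K)) : ℂ))]
  exact (mul_eq_zero.1 h_geom).resolve_right (sub_ne_zero.2 h_ne)

/-- The Fejér kernel of order `K` on `ℝ / ℤ`, normalised so that its translates by the multiples
of `1 / K` form a partition of unity. -/
noncomputable def fejer (K : ℕ) (x : ℝ) : ℝ := ‖∑ k : Fin K, (𝐞 (k * x) : ℂ)‖ ^ 2 / K ^ 2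

theorem fejer_nonneg (K : ℕ) (x : ℝ) : 0 ≤ fejer K x := by
  unfold fejer
  positivity

theorem fejer_le {K : ℕ} {x r : ℝ} (hr : 0 < r) (hrx : r < distNearestInt x) :
    fejer K x ≤ 1 / r ^ 2 / K ^ 2 := by
  have h_sum := norm_sum_fourierChar_mul_distNearestInt_le K x
  rw [← Fin.sum_univ_eq_sum_range (fun k => (𝐞 (k * x) : ℂ))] at h_sum
  unfold fejer
  gcongr
  rw [← one_div_pow]
  gcongr
  rw [le_div_iff₀ hr]
  exact (mul_le_mul_of_nonneg_left hrx.le (norm_nonneg _)).trans h_sum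

theorem sum_fejer {K : ℕ} (hK : 0 < K) (x : ℝ) : ∑ j : Fin K, fejer K (x - j / K) = 1 := by
  have h_term : ∀ j k l : Fin K,
      (𝐞 (k * (x - j / K)) : ℂ) * conj (𝐞 (l * (x - j / K)) : ℂ)
        = 𝐞 ((k - l) * x) * 𝐞 (j * ((l - k : ℝ) / K)) := by
    intro j k l
    rw [fourierChar_mul_conj_fourierChar, ← Circle.coe_mul, ← AddChar.map_add_eq_mul]
    congr 3
    ring
  have h_sum : ∑ j : Fin K, ‖∑ k : Fin K, (𝐞 (k * (x - j / K)) : ℂ)‖ ^ 2 = (K : ℝ) ^ 2 := by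
    rw [← Complex.ofReal_inj, Complex.ofReal_sum]
    simp_rw [ofReal_norm_sum_sq, h_term]
    calc ∑ j : Fin K, ∑ k : Fin K, ∑ l : Fin K,
          (𝐞 ((k - l) * x) : ℂ) * 𝐞 (j * ((l - k : ℝ) / K))
        = ∑ k : Fin K, ∑ l : Fin K, (𝐞 ((k - l) * x) : ℂ) * if l = k then (K : ℂ) else 0 := by
          simp_rw [← sum_fourierChar_mul_sub_div, mul_sum]
          rw [sum_comm]
          exact sum_congr rfl fun k _ => sum_comm
      _ = ((K ^ 2 : ℝ) : ℂ) := by simp [sq]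
  have hK' : (K : ℝ) ≠ 0 := by exact_mod_cast hK.ne'
  simp_rw [fejer, ← sum_div, h_sum]
  exact div_self (pow_ne_zero 2 hK')

section TorusFejer

variable {ι κ : Type*} [Fintype ι] {K : ℕ}

/-- The product of the one-dimensional Fejér kernels, as a kernel on the torus `(ℝ / ℤ) ^ ι`. -/
noncomputable def torusFejer (K : ℕ) (x : ι → ℝ) : ℝ := ∏ i, fejer K (x i)

/-- The points `j / K` of the torus `(ℝ / ℤ) ^ ι`, at which the Fejér kernels are centred. -/
noncomputable def gridPoint (j : ι → Fin K) : ι → ℝ := fun i => j i / K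

theorem torusFejer_nonneg (K : ℕ) (x : ι → ℝ) : 0 ≤ torusFejer K x :=
  prod_nonneg fun _ _ => fejer_nonneg K _

theorem sum_torusFejer [DecidableEq ι] (hK : 0 < K) (x : ι → ℝ) :
    ∑ j : ι → Fin K, torusFejer K (x - gridPoint j) = 1 :=
  calc ∑ j : ι → Fin K, torusFejer K (x - gridPoint j)
      = ∏ i, ∑ k : Fin K, fejer K (x i - k / K) := by
        rw [prod_univ_sum, Fintype.piFinset_univ]
        rfl
    _ = 1 := prod_eq_one fun i _ => sum_fejer hK (x i)

theorem sum_torusFejer_far_le [DecidableEq ι] (hK : 0 < K) {r : ℝ} (hr : 0 < r) (x : ι → ℝ)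
    (i : ι) :
    ∑ j : ι → Fin K with r < distNearestInt (x i - gridPoint j i), torusFejer K (x - gridPoint j)
      ≤ 1 / (K * r ^ 2) := by
  classical
  let far : ι → Finset (Fin K) := fun i' => {k | i' = i → r < distNearestInt (x i - k / K)}
  have h_far : ({j | r < distNearestInt (x i - gridPoint j i)} : Finset (ι → Fin K))
      = Fintype.piFinset far := by
    ext j
    rw [mem_filter_univ, Fintype.mem_piFinset]
    simp [far, gridPoint]
  have h_axis : ∀ i' ≠ i, ∑ k ∈ far i', fejer K (x i' - k / K) = 1 := by
    intro i' hi'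
    simpa [far, hi'] using sum_fejer hK (x i')
  calc ∑ j : ι → Fin K with r < distNearestInt (x i - gridPoint j i), torusFejer K (x - gridPoint j)
      = ∏ i', ∑ k ∈ far i', fejer K (x i' - k / K) := by
        rw [h_far, prod_univ_sum]
        rfl
    _ = ∑ k ∈ far i, fejer K (x i - k / K) :=
        prod_eq_single i (fun i' _ hi' => h_axis i' hi') fun h => absurd (mem_univ i) h
    _ ≤ ∑ k ∈ far i, 1 / r ^ 2 / K ^ 2 :=
        sum_le_sum fun k hk => fejer_le hr ((mem_filter.1 hk).2 rfl)
    _ ≤ K * (1 / r ^ 2 / K ^ 2) := by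
        rw [sum_const, nsmul_eq_mul]
        gcongr
        exact (card_le_univ _).trans_eq (Fintype.card_fin K)
    _ = 1 / (K * r ^ 2) := by field_simp

theorem torusFejer_eq [DecidableEq ι] (K : ℕ) (x : ι → ℝ) :
    (torusFejer K x : ℂ) = (∑ k : ι → Fin K, ∑ l : ι → Fin K,
      (𝐞 (∑ i, ((k i : ℤ) - l i : ℤ) * x i) : ℂ)) / (K ^ Fintype.card ι) ^ 2 := by
  have h_prod : torusFejer K x
      = ‖∑ k : ι → Fin K, (𝐞 (∑ i, k i * x i) : ℂ)‖ ^ 2 / (K ^ Fintype.card ι) ^ 2 := by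
    simp_rw [torusFejer, fejer, prod_div_distrib, prod_pow, ← norm_prod, prod_univ_sum,
      Fintype.piFinset_univ, ← fourierChar_sum, prod_const, card_univ]
  rw [h_prod, Complex.ofReal_div, ofReal_norm_sum_sq]
  simp_rw [fourierChar_mul_conj_fourierChar, ← sum_sub_distrib, ← sub_mul]
  push_cast
  rfl

theorem norm_sum_fourierChar_sub (S : Finset κ) (x : κ → ι → ℝ) (y : ι → ℝ) (h : ι → ℤ) :
    ‖∑ m ∈ S, (𝐞 (∑ i, h i * (x m - y) i) : ℂ)‖ = ‖∑ m ∈ S, (𝐞 (∑ i, h i * x m i) : ℂ)‖ := by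
  have h_factor : ∑ m ∈ S, (𝐞 (∑ i, h i * (x m - y) i) : ℂ)
      = 𝐞 (-∑ i, h i * y i) * ∑ m ∈ S, (𝐞 (∑ i, h i * x m i) : ℂ) := by
    simp_rw [mul_sum, ← Circle.coe_mul, ← AddChar.map_add_eq_mul, Pi.sub_apply, mul_sub,
      sum_sub_distrib, neg_add_eq_sub]
  rw [h_factor, norm_mul, Circle.norm_coe, one_mul]

theorem abs_sum_torusFejer_sub_le (hK : 0 < K) {S : Finset κ} {x : κ → ι → ℝ} {E : ℝ}
    (hE₀ : 0 ≤ E)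
    (hE : ∀ h : ι → ℤ, h ≠ 0 → (∀ i, |h i| ≤ K) → ‖∑ m ∈ S, (𝐞 (∑ i, h i * x m i) : ℂ)‖ ≤ E) :
    |∑ m ∈ S, torusFejer K (x m) - #S / K ^ Fintype.card ι| ≤ E := by
  classical
  set n : ℕ := K ^ Fintype.card ι with hn
  have hn₀ : (0 : ℝ) < n := by exact_mod_cast pow_pos hK _
  have h_card : #(univ : Finset (ι → Fin K)) = n := by
    rw [card_univ, Fintype.card_fun, Fintype.card_fin]
  let e : (ι → Fin K) → (ι → Fin K) → κ → ℂ := fun k l m =>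
    𝐞 (∑ i, ((k i : ℤ) - l i : ℤ) * x m i)
  have h_coeff : ∀ k l, ‖∑ m ∈ S, e k l m - if k = l then (#S : ℂ) else 0‖ ≤ E := by
    intro k l
    split_ifs with hkl
    · simpa [e, hkl] using hE₀
    have h_ne : (fun i => (k i : ℤ) - l i) ≠ 0 := fun h =>
      hkl (funext fun i => Fin.ext (by exact_mod_cast sub_eq_zero.1 (congrFun h i)))
    rw [sub_zero]
    exact hE _ h_ne fun i => by rw [abs_le]; omega
  have h_expand : ((∑ m ∈ S, torusFejer K (x m) - #S / n : ℝ) : ℂ)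
      = (∑ k, ∑ l, (∑ m ∈ S, e k l m - if k = l then (#S : ℂ) else 0)) / n ^ 2 := by
    have h_comm : ∑ m ∈ S, ∑ k, ∑ l, e k l m = ∑ k, ∑ l, ∑ m ∈ S, e k l m := by
      rw [sum_comm]
      exact sum_congr rfl fun k _ => sum_comm
    simp only [Complex.ofReal_sub, Complex.ofReal_sum, torusFejer_eq, ← sum_div, sum_sub_distrib,
      sum_ite_eq, mem_univ, if_true, sum_const, h_card, nsmul_eq_mul, ← h_comm]
    simp only [e, hn]
    push_cast
    field_simp
  calc |∑ m ∈ S, torusFejer K (x m) - #S / K ^ Fintype.card ι|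
      = ‖((∑ m ∈ S, torusFejer K (x m) - #S / n : ℝ) : ℂ)‖ := by
        rw [Complex.norm_real, Real.norm_eq_abs, hn, Nat.cast_pow]
    _ ≤ (n * (n * E)) / n ^ 2 := by
        rw [h_expand, norm_div, norm_pow, Complex.norm_natCast]
        gcongr
        rw [← nsmul_eq_mul, ← nsmul_eq_mul, ← h_card, ← sum_const, ← sum_const]
        exact norm_sum_le_of_le _ fun k _ => norm_sum_le_of_le _ fun l _ => h_coeff k l
    _ = E := by field_simp

variable {F : (ι → ℝ) → ℝ} {B : Finset (ι → Fin K)} {δ : ℝ}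

theorem abs_sub_mul_torusFejer_le (hF₁ : ∀ x, |F x| ≤ 1)
    (hF : ∀ x, ∀ j ∉ B, (∀ i, distNearestInt (x i - gridPoint j i) ≤ δ) → F x = F (gridPoint j))
    (x : ι → ℝ) (j : ι → Fin K) :
    |(F x - F (gridPoint j)) * torusFejer K (x - gridPoint j)|
      ≤ 2 * (if j ∈ B then torusFejer K (x - gridPoint j) else 0)
        + 2 * ∑ i, if δ < distNearestInt (x i - gridPoint j i) then
            torusFejer K (x - gridPoint j) else 0 := by
  have hΦ := torusFejer_nonneg K (x - gridPoint j)
  have h_two : |(F x - F (gridPoint j)) * torusFejer K (x - gridPoint j)|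
      ≤ 2 * torusFejer K (x - gridPoint j) := by
    rw [abs_mul, abs_of_nonneg hΦ]
    gcongr
    linarith [abs_sub (F x) (F (gridPoint j)), hF₁ x, hF₁ (gridPoint j)]
  have h_far : ∀ i, 0 ≤ if δ < distNearestInt (x i - gridPoint j i) then
      torusFejer K (x - gridPoint j) else 0 := fun i => by positivity
  by_cases hj : j ∈ B
  · rw [if_pos hj]
    linarith [sum_nonneg fun i (_ : i ∈ univ) => h_far i]
  by_cases h_near : ∀ i, distNearestInt (x i - gridPoint j i) ≤ δ
  · rw [hF x j hj h_near, sub_self, zero_mul, abs_zero, if_neg hj]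
    linarith [sum_nonneg fun i (_ : i ∈ univ) => h_far i]
  · push Not at h_near
    obtain ⟨i, hi⟩ := h_near
    have h_single := single_le_sum (fun i _ => h_far i) (mem_univ i)
    rw [if_pos hi] at h_single
    rw [if_neg hj]
    linarith

variable [DecidableEq ι]

theorem abs_sub_sum_gridPoint_mul_torusFejer_le (hK : 0 < K) (hδ : 0 < δ) (hF₁ : ∀ x, |F x| ≤ 1)
    (hF : ∀ x, ∀ j ∉ B, (∀ i, distNearestInt (x i - gridPoint j i) ≤ δ) → F x = F (gridPoint j))
    (x : ι → ℝ) :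
    |F x - ∑ j : ι → Fin K, F (gridPoint j) * torusFejer K (x - gridPoint j)|
      ≤ 2 * ∑ j ∈ B, torusFejer K (x - gridPoint j)
        + 2 * Fintype.card ι * (1 / (K * δ ^ 2)) := by
  have h_partition : F x - ∑ j : ι → Fin K, F (gridPoint j) * torusFejer K (x - gridPoint j)
      = ∑ j : ι → Fin K, (F x - F (gridPoint j)) * torusFejer K (x - gridPoint j) := by
    simp_rw [sub_mul, sum_sub_distrib, ← mul_sum, sum_torusFejer hK, mul_one]
  have h_far : ∑ j : ι → Fin K, ∑ i, (if δ < distNearestInt (x i - gridPoint j i) then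
      torusFejer K (x - gridPoint j) else 0) ≤ Fintype.card ι * (1 / (K * δ ^ 2)) := by
    rw [sum_comm, ← nsmul_eq_mul]
    refine sum_le_card_nsmul _ _ _ fun i _ => ?_
    rw [← sum_filter]
    exact sum_torusFejer_far_le hK hδ x i
  calc |F x - ∑ j : ι → Fin K, F (gridPoint j) * torusFejer K (x - gridPoint j)|
      ≤ ∑ j : ι → Fin K, (2 * (if j ∈ B then torusFejer K (x - gridPoint j) else 0)
        + 2 * ∑ i, if δ < distNearestInt (x i - gridPoint j i) then
            torusFejer K (x - gridPoint j) else 0) := by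
        rw [h_partition]
        exact (abs_sum_le_sum_abs _ _).trans
          (sum_le_sum fun j _ => abs_sub_mul_torusFejer_le hF₁ hF x j)
    _ ≤ _ := by
        rw [sum_add_distrib, ← mul_sum, ← mul_sum, sum_ite_mem, univ_inter, mul_assoc 2]
        gcongr

theorem abs_sum_sub_sum_gridPoint_le (hK : 0 < K) (hδ : 0 < δ) (hF₁ : ∀ x, |F x| ≤ 1)
    (hF : ∀ x, ∀ j ∉ B, (∀ i, distNearestInt (x i - gridPoint j i) ≤ δ) → F x = F (gridPoint j))
    {S : Finset κ} {x : κ → ι → ℝ} {E : ℝ} (hE₀ : 0 ≤ E)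
    (hE : ∀ h : ι → ℤ, h ≠ 0 → (∀ i, |h i| ≤ K) → ‖∑ m ∈ S, (𝐞 (∑ i, h i * x m i) : ℂ)‖ ≤ E) :
    |∑ m ∈ S, F (x m) - #S / K ^ Fintype.card ι * ∑ j : ι → Fin K, F (gridPoint j)|
      ≤ K ^ Fintype.card ι * E + 2 * (#B * (#S / K ^ Fintype.card ι + E))
        + 2 * Fintype.card ι * (#S / (K * δ ^ 2)) := by
  set W : (ι → Fin K) → ℝ := fun j => ∑ m ∈ S, torusFejer K (x m - gridPoint j) with hW
  have h_equi : ∀ j, |W j - #S / K ^ Fintype.card ι| ≤ E := fun j =>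
    abs_sum_torusFejer_sub_le (x := fun m => x m - gridPoint j) hK hE₀ fun h h₀ hh =>
      (norm_sum_fourierChar_sub S x (gridPoint j) h).trans_le (hE h h₀ hh)
  have h_approx : |∑ m ∈ S, F (x m) - ∑ j, F (gridPoint j) * W j|
      ≤ 2 * ∑ j ∈ B, W j + 2 * Fintype.card ι * (#S / (K * δ ^ 2)) := by
    have h_exchange : ∑ m ∈ S, F (x m) - ∑ j, F (gridPoint j) * W j
        = ∑ m ∈ S, (F (x m) - ∑ j : ι → Fin K,
            F (gridPoint j) * torusFejer K (x m - gridPoint j)) := by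
      simp_rw [hW, mul_sum, sum_sub_distrib]
      rw [sum_comm]
    have h_sum : ∑ m ∈ S, (2 * ∑ j ∈ B, torusFejer K (x m - gridPoint j)
          + 2 * Fintype.card ι * (1 / (K * δ ^ 2)))
        = 2 * ∑ j ∈ B, W j + 2 * Fintype.card ι * (#S / (K * δ ^ 2)) := by
      rw [sum_add_distrib, ← mul_sum, sum_comm, sum_const, nsmul_eq_mul]
      ring
    rw [h_exchange, ← h_sum]
    exact (abs_sum_le_sum_abs _ _).trans
      (sum_le_sum fun m _ => abs_sub_sum_gridPoint_mul_torusFejer_le hK hδ hF₁ hF (x m))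
  have h_replace : |∑ j, F (gridPoint j) * W j
      - #S / K ^ Fintype.card ι * ∑ j : ι → Fin K, F (gridPoint j)| ≤ K ^ Fintype.card ι * E := by
    rw [mul_sum, ← sum_sub_distrib]
    refine (abs_sum_le_sum_abs _ _).trans ((sum_le_card_nsmul _ _ E fun j _ => ?_).trans_eq ?_)
    · rw [mul_comm (#S / _ : ℝ), ← mul_sub, abs_mul]
      exact (mul_le_of_le_one_left (abs_nonneg _) (hF₁ _)).trans (h_equi j)
    · rw [card_univ, Fintype.card_fun, Fintype.card_fin, nsmul_eq_mul, Nat.cast_pow]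
  have h_bad : ∑ j ∈ B, W j ≤ #B * (#S / K ^ Fintype.card ι + E) := by
    rw [← nsmul_eq_mul]
    exact sum_le_card_nsmul _ _ _ fun j _ => by linarith [(abs_le.1 (h_equi j)).2]
  calc _ ≤ |∑ m ∈ S, F (x m) - ∑ j, F (gridPoint j) * W j| + |∑ j, F (gridPoint j) * W j
      - #S / K ^ Fintype.card ι * ∑ j : ι → Fin K, F (gridPoint j)| := abs_sub_le _ _ _
    _ ≤ _ := by linarith only [h_approx, h_replace, h_bad]

end TorusFejer

theorem card_Icc_ceil_floor_le {a b : ℝ} (hab : a ≤ b) : (#(Icc ⌈a⌉ ⌊b⌋) : ℝ) ≤ b - a + 1 := by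
  have h_toNat : ((⌊b⌋ + 1 - ⌈a⌉).toNat : ℝ) = max (⌊b⌋ + 1 - ⌈a⌉ : ℝ) 0 := by
    exact_mod_cast Int.toNat_eq_max _
  rw [Int.card_Icc, h_toNat]
  exact max_le (by linarith [Int.le_ceil a, Int.floor_le b]) (by linarith)

theorem card_distNearestInt_div_sub_le {K : ℕ} {r : ℝ} (hr : 0 ≤ r) (c : ℝ) :
    (#{k : Fin K | distNearestInt (k / K - c) ≤ r} : ℝ) ≤ 2 * (K * r) + 1 := by
  let lift : Fin K → ℤ := fun k => k - K * round (k / K - c : ℝ)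
  have h_maps : ∀ k : Fin K, distNearestInt (k / K - c) ≤ r →
      lift k ∈ Icc ⌈K * (c - r)⌉ ⌊K * (c + r)⌋ := by
    intro k hk
    have hK : (0 : ℝ) < K := by exact_mod_cast Fin.pos k
    have h_cancel : (k / K : ℝ) * K = k := div_mul_cancel₀ _ hK.ne'
    rw [distNearestInt, abs_le] at hk
    rw [mem_Icc, Int.ceil_le, Int.le_floor]
    push_cast [lift]
    constructor <;> nlinarith
  have h_inj : lift.Injective := by
    intro k l hkl
    have h_dvd : (K : ℤ) ∣ (k : ℤ) - l :=
      ⟨round (k / K - c : ℝ) - round (l / K - c : ℝ), by linear_combination hkl⟩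
    have h_zero : (k : ℤ) - l = 0 := Int.eq_zero_of_abs_lt_dvd h_dvd (by rw [abs_lt]; omega)
    exact Fin.ext (by omega)
  have h_card : #{k : Fin K | distNearestInt (k / K - c) ≤ r}
      ≤ #(Icc ⌈K * (c - r)⌉ ⌊K * (c + r)⌋) :=
    card_le_card_of_injOn lift (fun k hk => h_maps k (mem_filter.1 hk).2) h_inj.injOn
  have h_Icc := card_Icc_ceil_floor_le (a := K * (c - r)) (b := K * (c + r)) (by gcongr; linarith)
  have h_cast : (#{k : Fin K | distNearestInt (k / K - c) ≤ r} : ℝ)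
      ≤ #(Icc ⌈K * (c - r)⌉ ⌊K * (c + r)⌋) := by exact_mod_cast h_card
  linarith

theorem card_gridPoint_near_graph_le {n K : ℕ} {r : ℝ} (hr : 0 ≤ r) (i : Fin (n + 1))
    (c : (Fin n → ℝ) → ℝ) :
    (#{j : Fin (n + 1) → Fin K |
        distNearestInt (gridPoint j i - c (i.removeNth (gridPoint j))) ≤ r} : ℝ)
      ≤ K ^ n * (2 * (K * r) + 1) :=
  calc (#{j : Fin (n + 1) → Fin K |
        distNearestInt (gridPoint j i - c (i.removeNth (gridPoint j))) ≤ r} : ℝ)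
      = ∑ j : Fin n → Fin K, (#{k : Fin K | distNearestInt (k / K - c (gridPoint j)) ≤ r} : ℝ) := by
        let e := Fin.insertNthEquiv (fun _ => Fin K) i
        have h_at : ∀ k j, gridPoint (e (k, j)) i = k / K := by
          simp [e, gridPoint, Fin.insertNthEquiv]
        have h_off : ∀ k j, i.removeNth (gridPoint (e (k, j))) = gridPoint j := by
          intro k j
          ext
          simp [e, gridPoint, Fin.insertNthEquiv, Fin.removeNth]
        simp_rw [← sum_boole]
        rw [← e.sum_comp, Fintype.sum_prod_type_right]
        simp_rw [h_at, h_off]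
    _ ≤ K ^ n * (2 * (K * r) + 1) := by
        refine (sum_le_card_nsmul _ _ _ fun j _ =>
          card_distNearestInt_div_sub_le hr (c (gridPoint j))).trans_eq ?_
        rw [card_univ, Fintype.card_fun, Fintype.card_fin, Fintype.card_fin, nsmul_eq_mul,
          Nat.cast_pow]

/-! ### The sign as a function on the torus -/

theorem abs_chiSign (x : ℝ) : |chiSign x| = 1 := by
  rw [chiSign]
  split_ifs <;> rfl

theorem chiSign_add_intCast (x : ℝ) (n : ℤ) : chiSign (x + n) = chiSign x := by
  rw [chiSign, chiSign, Int.floor_add_intCast]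
  push_cast
  rw [add_sub_add_right_eq_sub]

theorem chiSign_eq_ite_floor (x : ℝ) : chiSign x = if ⌊x - 1 / 2⌋ < ⌊x⌋ then 1 else -1 := by
  rw [chiSign]
  congr 1
  rw [Int.floor_lt, eq_iff_iff]
  constructor <;> intro h <;> linarith

theorem chiSign_add_half (x : ℝ) : chiSign (x + 1 / 2) = -chiSign x := by
  have h_shift : ⌊x + 1 / 2⌋ = ⌊x - 1 / 2⌋ + 1 := by
    rw [← Int.floor_add_one]
    ring_nf
  have h_le : ⌊x - 1 / 2⌋ ≤ ⌊x⌋ := Int.floor_mono (by linarith)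
  have h_ge : ⌊x⌋ ≤ ⌊x - 1 / 2⌋ + 1 := by
    rw [← h_shift]
    exact Int.floor_mono (by linarith)
  rw [chiSign_eq_ite_floor, chiSign_eq_ite_floor x, add_sub_cancel_right, h_shift]
  split_ifs <;> omega

theorem chiSign_add_eq_of_abs_lt_distNearestInt {x s : ℝ} (h : |s| < distNearestInt x)
    (h_half : |s| < distNearestInt (x - 1 / 2)) : chiSign (x + s) = chiSign x := by
  rw [chiSign_eq_ite_floor, chiSign_eq_ite_floor x, floor_add_eq_of_abs_lt_distNearestInt h,
    add_sub_right_comm, floor_add_eq_of_abs_lt_distNearestInt h_half]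

theorem sum_chiSign_div_sub {K : ℕ} (hK : Even K) (c : ℝ) :
    ∑ k : Fin K, chiSign (k / K - c) = 0 := by
  obtain ⟨H, rfl⟩ := hK
  have h_half : ∀ k ∈ range H, chiSign (((H + k : ℕ) : ℝ) / (H + H : ℕ) - c)
      = -chiSign ((k : ℝ) / (H + H : ℕ) - c) := by
    intro k hk
    have hH : (H : ℝ) ≠ 0 := by exact_mod_cast (Nat.zero_lt_of_lt (mem_range.1 hk)).ne'
    rw [← chiSign_add_half]
    congr 1
    push_cast
    field_simp
    ring
  rw [Fin.sum_univ_eq_sum_range (fun k : ℕ => chiSign ((k : ℝ) / (H + H : ℕ) - c)),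
    sum_range_add, sum_congr rfl h_half, sum_neg_distrib, add_neg_cancel]

/-- The discrepancy `β (v - ⌊v - α₁ {u}⌋)` between `α₁ α₂ β p` and `β ⌊α₁ ⌊α₂ p⌋⌋`, in terms of
`u = α₂ p` and `v = α₁ α₂ p`; it depends only on `u` and `v` modulo `1`. -/
noncomputable def phaseShift (α₁ β u v : ℝ) : ℝ := β * (v - ⌊v - α₁ * Int.fract u⌋)

theorem genPoly_eq_sub_phaseShift (α₁ α₂ β : ℝ) (p : ℝ[X]) (x : ℝ) :
    genPoly α₁ α₂ β p x
      = α₁ * α₂ * β * p.eval x - phaseShift α₁ β (α₂ * p.eval x) (α₁ * α₂ * p.eval x) := by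
  have h_inner : α₁ * α₂ * p.eval x - α₁ * Int.fract (α₂ * p.eval x)
      = α₁ * ⌊α₂ * p.eval x⌋ := by
    rw [Int.fract]
    ring
  rw [genPoly, phaseShift, h_inner]
  ring

theorem phaseShift_add_intCast (α₁ β u v : ℝ) (k l : ℤ) :
    phaseShift α₁ β (u + k) (v + l) = phaseShift α₁ β u v := by
  rw [phaseShift, phaseShift, Int.fract_add_intCast, add_sub_right_comm v _ (α₁ * _),
    Int.floor_add_intCast]
  push_cast
  ring

theorem phaseShift_add {α₁ β u v s₀ s₁ : ℝ} (h₀ : |s₀| < distNearestInt u)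
    (h₁ : |s₁ - α₁ * s₀| < distNearestInt (v - α₁ * Int.fract u)) :
    phaseShift α₁ β (u + s₀) (v + s₁) = phaseShift α₁ β u v + β * s₁ := by
  have h_inner : v + s₁ - α₁ * (Int.fract u + s₀)
      = v - α₁ * Int.fract u + (s₁ - α₁ * s₀) := by ring
  rw [phaseShift, phaseShift, fract_add_eq_of_abs_lt_distNearestInt h₀, h_inner,
    floor_add_eq_of_abs_lt_distNearestInt h₁]
  ring

/-- The sign `χ(β ⌊α₁ ⌊α₂ p⌋⌋)` as a `ℤ³`-periodic function of
`(α₂ p, α₁ α₂ p, α₁ α₂ β p)`. -/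
noncomputable def torusSign (α₁ β : ℝ) (x : Fin 3 → ℝ) : ℤ :=
  chiSign (x 2 - phaseShift α₁ β (x 0) (x 1))

/-- The `r`-neighbourhood of the discontinuities of `torusSign`: the jumps of `{x₀}`, of the floor
in `phaseShift`, and of `χ` (at the integers and at the half-integers). -/
def NearJump (α₁ β r : ℝ) (x : Fin 3 → ℝ) : Prop :=
  distNearestInt (x 0) ≤ r ∨ distNearestInt (x 1 - α₁ * Int.fract (x 0)) ≤ r ∨
    distNearestInt (x 2 - phaseShift α₁ β (x 0) (x 1)) ≤ r ∨
    distNearestInt (x 2 - (phaseShift α₁ β (x 0) (x 1) + 1 / 2)) ≤ r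

theorem inducedSeq_genPoly (α₁ α₂ β : ℝ) (p : ℝ[X]) (n : ℤ) :
    inducedSeq (genPoly α₁ α₂ β p) n
      = torusSign α₁ β (fun i => ![α₂, α₁ * α₂, α₁ * α₂ * β] i * p.eval (n : ℝ)) := by
  rw [inducedSeq, genPoly_eq_sub_phaseShift]
  rfl

theorem abs_torusSign (α₁ β : ℝ) (x : Fin 3 → ℝ) : |torusSign α₁ β x| = 1 := abs_chiSign _

theorem torusSign_add_intCast (α₁ β : ℝ) (x : Fin 3 → ℝ) (n : Fin 3 → ℤ) :
    torusSign α₁ β (fun i => x i + n i) = torusSign α₁ β x := by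
  rw [torusSign, phaseShift_add_intCast, add_sub_right_comm, chiSign_add_intCast, torusSign]

theorem torusSign_add {α₁ β δ : ℝ} {y s : Fin 3 → ℝ}
    (hy : ¬NearJump α₁ β ((1 + |α₁| + |β|) * δ) y) (hs : ∀ i, |s i| ≤ δ) :
    torusSign α₁ β (fun i => y i + s i) = torusSign α₁ β y := by
  have hδ : 0 ≤ δ := (abs_nonneg _).trans (hs 0)
  have hα : 0 ≤ |α₁| * δ := by positivity
  have hβ : 0 ≤ |β| * δ := by positivity
  have h_comb : ∀ c : ℝ, ∀ i j, |s i - c * s j| ≤ δ + |c| * δ := fun c i j =>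
    (abs_sub _ _).trans (by rw [abs_mul]; gcongr <;> exact hs _)
  have h₁ := h_comb α₁ 1 0
  have h₂ := h_comb β 2 1
  simp only [NearJump, not_or, not_le, ← sub_sub] at hy
  obtain ⟨hy₀, hy₁, hy₂, hy₃⟩ := hy
  rw [torusSign, phaseShift_add (by linarith [hs 0]) (by linarith),
    show y 2 + s 2 - (phaseShift α₁ β (y 0) (y 1) + β * s 1)
      = y 2 - phaseShift α₁ β (y 0) (y 1) + (s 2 - β * s 1) by ring,
    chiSign_add_eq_of_abs_lt_distNearestInt (by linarith) (by linarith), torusSign]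

theorem torusSign_eq_of_distNearestInt_le {α₁ β δ : ℝ} {x y : Fin 3 → ℝ}
    (hy : ¬NearJump α₁ β ((1 + |α₁| + |β|) * δ) y) (hxy : ∀ i, distNearestInt (x i - y i) ≤ δ) :
    torusSign α₁ β x = torusSign α₁ β y := by
  choose s n hx hs using fun i => exists_eq_add_add_intCast (x i) (y i)
  rw [funext hx, torusSign_add_intCast, torusSign_add hy fun i => (hs i).trans_le (hxy i)]

theorem sum_torusSign_gridPoint (α₁ β : ℝ) {K : ℕ} (hK : Even K) :
    ∑ j : Fin 3 → Fin K, torusSign α₁ β (gridPoint j) = 0 := by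
  rw [← (Fin.insertNthEquiv (fun _ => Fin K) 2).sum_comp, Fintype.sum_prod_type_right]
  exact sum_eq_zero fun j _ =>
    sum_chiSign_div_sub hK (phaseShift α₁ β ((j 0 : ℕ) / K) ((j 1 : ℕ) / K))

theorem exists_card_le_forall_notMem_not_nearJump (α₁ β : ℝ) {r : ℝ} (hr : 0 ≤ r) (K : ℕ) :
    ∃ B : Finset (Fin 3 → Fin K), (#B : ℝ) ≤ 4 * (K ^ 2 * (2 * (K * r) + 1)) ∧
      ∀ j ∉ B, ¬NearJump α₁ β r (gridPoint j) := by
  have h_graph := card_gridPoint_near_graph_le (n := 2) (K := K) hr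
  let B₀ : Finset (Fin 3 → Fin K) := {j | distNearestInt (gridPoint j 0 - 0) ≤ r}
  let B₁ : Finset (Fin 3 → Fin K) :=
    {j | distNearestInt (gridPoint j 1 - α₁ * Int.fract (gridPoint j 0)) ≤ r}
  let B₂ : Finset (Fin 3 → Fin K) :=
    {j | distNearestInt (gridPoint j 2 - phaseShift α₁ β (gridPoint j 0) (gridPoint j 1)) ≤ r}
  let B₃ : Finset (Fin 3 → Fin K) :=
    {j | distNearestInt
      (gridPoint j 2 - (phaseShift α₁ β (gridPoint j 0) (gridPoint j 1) + 1 / 2)) ≤ r}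
  refine ⟨B₀ ∪ B₁ ∪ B₂ ∪ B₃, ?_, fun j hj => ?_⟩
  · have h₀ := h_graph 0 fun _ => 0
    have h₁ := h_graph 1 fun y => α₁ * Int.fract (y 0)
    have h₂ := h_graph 2 fun y => phaseShift α₁ β (y 0) (y 1)
    have h₃ := h_graph 2 fun y => phaseShift α₁ β (y 0) (y 1) + 1 / 2
    have h_union : #(B₀ ∪ B₁ ∪ B₂ ∪ B₃) ≤ #B₀ + #B₁ + #B₂ + #B₃ := by
      grw [card_union_le, card_union_le, card_union_le]
    calc (#(B₀ ∪ B₁ ∪ B₂ ∪ B₃) : ℝ) ≤ #B₀ + #B₁ + #B₂ + #B₃ := by exact_mod_cast h_union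
      _ ≤ K ^ 2 * (2 * (K * r) + 1) + K ^ 2 * (2 * (K * r) + 1) + K ^ 2 * (2 * (K * r) + 1)
          + K ^ 2 * (2 * (K * r) + 1) := add_le_add (add_le_add (add_le_add h₀ h₁) h₂) h₃
      _ = 4 * (K ^ 2 * (2 * (K * r) + 1)) := by ring
  · simp only [B₀, B₁, B₂, B₃, mem_union, mem_filter_univ, sub_zero, or_assoc] at hj
    exact hj

theorem abs_sum_torusSign_le {κ : Type*} {α₁ β : ℝ} {J K : ℕ} (hJ : 0 < J) (hK : K = 2 * J ^ 3)
    {S : Finset κ} {x : κ → Fin 3 → ℝ}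
    (hS : ∀ h : Fin 3 → ℤ, h ≠ 0 → (∀ i, |h i| ≤ K) →
      ‖∑ m ∈ S, (𝐞 (∑ i, h i * x m i) : ℂ)‖ ≤ 6 * #S / (K : ℝ) ^ 4) :
    |∑ m ∈ S, (torusSign α₁ β (x m) : ℝ)| ≤ (34 + 112 * (1 + |α₁| + |β|)) * (#S / J) := by
  set L := 1 + |α₁| + |β|
  have hL : 0 ≤ L := by positivity
  have hJ₁ : (1 : ℝ) ≤ J := by exact_mod_cast hJ
  have hJ₀ : (0 : ℝ) < J := by linarith
  have hK_eq : (K : ℝ) = 2 * J ^ 3 := by exact_mod_cast hK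
  have hK₀ : (0 : ℝ) < K := by rw [hK_eq]; positivity
  have hJK : 2 * (J : ℝ) ≤ K := by rw [hK_eq]; gcongr; exact le_self_pow₀ hJ₁ (by norm_num)
  have h_inv : 1 / (K : ℝ) ≤ 1 / (2 * J) := by gcongr
  obtain ⟨B, hB_card, hB⟩ :=
    exists_card_le_forall_notMem_not_nearJump α₁ β (r := L * (1 / J)) (by positivity) K
  have h_quad := abs_sum_sub_sum_gridPoint_le (F := fun y => (torusSign α₁ β y : ℝ)) (B := B)
    (by exact_mod_cast hK₀) (one_div_pos.2 hJ₀)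
    (fun y => by exact_mod_cast (abs_torusSign α₁ β y).le)
    (fun y j hj hy => by exact_mod_cast torusSign_eq_of_distNearestInt_le (hB j hj) hy)
    (by positivity) hS
  have h_mean : ∑ j : Fin 3 → Fin K, (torusSign α₁ β (gridPoint j) : ℝ) = 0 := by
    exact_mod_cast sum_torusSign_gridPoint α₁ β (hK ▸ even_two_mul _)
  rw [h_mean, mul_zero, sub_zero, Fintype.card_fin] at h_quad
  have h_frequencies : (K : ℝ) ^ 3 * (6 * #S / K ^ 4) ≤ 3 * (#S / J) :=
    calc (K : ℝ) ^ 3 * (6 * #S / K ^ 4) = 6 * #S * (1 / K) := by field_simp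
      _ ≤ 6 * #S * (1 / (2 * J)) := by gcongr
      _ = 3 * (#S / J) := by ring
  have h_jumps : 2 * (#B * (#S / K ^ 3 + 6 * #S / K ^ 4)) ≤ (28 + 112 * L) * (#S / J) :=
    calc 2 * (#B * (#S / K ^ 3 + 6 * #S / K ^ 4))
        ≤ 2 * (4 * (K ^ 2 * (2 * (K * (L * (1 / J))) + 1)) * (#S / K ^ 3 + 6 * #S / K ^ 3)) := by
          gcongr
          · linarith
          · norm_num
      _ = 56 * #S * (2 * L / J + 1 / K) := by field_simp; ring
      _ ≤ 56 * #S * (2 * L / J + 1 / (2 * J)) := by gcongr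
      _ = (28 + 112 * L) * (#S / J) := by ring
  have h_transition : 2 * ((3 : ℕ) : ℝ) * (#S / (K * (1 / J) ^ 2)) = 3 * (#S / J) := by
    rw [hK_eq]
    field_simp
    push_cast
    ring
  linarith

/-! ### Exponential sums for vectors of finite type -/

theorem IsOfFiniteType.exists_one_le_mul_distNearestInt {s : ℕ} {γ : Fin s → ℝ} {t : ℝ}
    (hγ : IsOfFiniteType γ t) : ∃ (c : ℝ) (T : ℕ), 0 < c ∧ ∀ (Q : ℝ) (n : Fin s → ℤ), 1 ≤ Q →
      n ≠ 0 → (∀ i, |(n i : ℝ)| ≤ Q) → 1 ≤ c * Q ^ T * distNearestInt (∑ i, n i * γ i) := by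
  set ε := 1 + |t|
  have hε : 0 < ε := by positivity
  have htε : 0 ≤ t + ε := by linarith [neg_abs_le t]
  obtain ⟨c, hc, h⟩ := hγ ε hε
  refine ⟨c⁻¹, ⌈t + ε⌉₊ * s, inv_pos.2 hc, fun Q n hQ hn hnQ => ?_⟩
  have h_weight : ∏ j, (max 1 |(n j : ℝ)|) ^ (t + ε) ≤ Q ^ (⌈t + ε⌉₊ * s) :=
    calc ∏ j, (max 1 |(n j : ℝ)|) ^ (t + ε) ≤ ∏ _j : Fin s, Q ^ ⌈t + ε⌉₊ := by
          refine prod_le_prod (fun j _ => by positivity) fun j _ => ?_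
          rw [← Real.rpow_natCast Q]
          exact (Real.rpow_le_rpow (by positivity) (max_le hQ (hnQ j)) htε).trans
            (Real.rpow_le_rpow_of_exponent_le hQ (Nat.le_ceil _))
      _ = Q ^ (⌈t + ε⌉₊ * s) := by rw [prod_const, card_univ, Fintype.card_fin, pow_mul]
  rw [mul_assoc, le_inv_mul_iff₀ hc, mul_one]
  exact (h n hn).trans (mul_le_mul_of_nonneg_right h_weight (distNearestInt_nonneg _))

theorem IsOfFiniteType.exists_isIrrationalUpTo {s : ℕ} {γ : Fin s → ℝ} {t : ℝ}
    (hγ : IsOfFiniteType γ t) : ∃ (c : ℝ) (T : ℕ), 0 < c ∧ ∀ (Q P : ℝ) (h : Fin s → ℤ), 1 ≤ Q →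
      1 ≤ P → h ≠ 0 → (∀ i, |(h i : ℝ)| ≤ P) →
      IsIrrationalUpTo (∑ i, h i * γ i) Q (c * (Q * P) ^ T) := by
  obtain ⟨c, T, hc, h_dist⟩ := hγ.exists_one_le_mul_distNearestInt
  refine ⟨c, T, hc, fun Q P h hQ hP hh hhP n hn hnQ => ?_⟩
  have h_mul : (n : ℝ) * ∑ i, h i * γ i = ∑ i, ((n • h) i : ℤ) * γ i := by
    simp only [mul_sum, Pi.smul_apply, smul_eq_mul, Int.cast_mul, mul_assoc]
  rw [h_mul]
  refine h_dist (Q * P) (n • h) (one_le_mul_of_one_le_of_one_le hQ hP) (smul_ne_zero hn hh)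
    fun i => ?_
  rw [Pi.smul_apply, smul_eq_mul, Int.cast_mul, abs_mul]
  exact mul_le_mul hnQ (hhP i) (abs_nonneg _) (by linarith)

theorem natDegree_comp_C_mul_X_add_C {R : Type*} [CommRing R] [IsDomain R] (p : R[X]) {a : R}
    (ha : a ≠ 0) (b : R) : (p.comp (C a * X + C b)).natDegree = p.natDegree := by
  rw [natDegree_comp, natDegree_linear ha, mul_one]

theorem coeff_natDegree_comp_C_mul_X_add_C {R : Type*} [CommRing R] [IsDomain R] (p : R[X])
    {a : R} (ha : a ≠ 0) (b : R) :
    (p.comp (C a * X + C b)).coeff p.natDegree = p.leadingCoeff * a ^ p.natDegree := by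
  have h_lead := leadingCoeff_comp (p := p) (q := C a * X + C b)
    (by rw [natDegree_linear ha]; exact one_ne_zero)
  rwa [leadingCoeff_linear ha, leadingCoeff, natDegree_comp_C_mul_X_add_C p ha] at h_lead

theorem norm_sum_fourierChar_mul_eval_progression_le {d R H M a : ℕ} {P Y b θ : ℝ} {p : ℝ[X]}
    (hp : p.Monic) (hd : p.natDegree = d + 1) (hR : 0 < R) (hH : R ^ 2 ^ d = H)
    (hHM : (H : ℝ) ^ 2 ≤ M) (hYM : Y * H ≤ M) (ha : a ≠ 0) (haP : (a : ℝ) ^ (d + 1) ≤ P)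
    (hθ : IsIrrationalUpTo θ ((d + 1).factorial * H ^ d * P) Y) :
    ‖∑ m ∈ range M, (𝐞 (θ * p.eval (a * (m : ℝ) + b)) : ℂ)‖ ≤ 6 * M / R := by
  have ha' : (a : ℝ) ≠ 0 := Nat.cast_ne_zero.2 ha
  set q : ℝ[X] := C θ * p.comp (C (a : ℝ) * X + C b)
  have h_eval : ∀ m : ℕ, q.eval (m : ℝ) = θ * p.eval (a * (m : ℝ) + b) := by simp [q]
  have h_coeff : q.coeff (d + 1) = ((a : ℤ) ^ (d + 1) : ℤ) * θ := by
    rw [coeff_C_mul, ← hd, coeff_natDegree_comp_C_mul_X_add_C p ha', hp.leadingCoeff]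
    push_cast
    ring
  have h_degree : q.natDegree ≤ d + 1 :=
    (natDegree_C_mul_le _ _).trans (by rw [natDegree_comp_C_mul_X_add_C p ha', hd])
  simp_rw [← h_eval]
  refine norm_sum_fourierChar_eval_le hR hH hHM hYM le_rfl h_degree ?_
  rw [h_coeff]
  refine hθ.intCast_mul (by positivity) ?_
  push_cast
  rwa [abs_of_nonneg (by positivity)]

theorem IsOfFiniteType.exists_norm_sum_fourierChar_le {s : ℕ} {γ : Fin s → ℝ} {t : ℝ}
    (hγ : IsOfFiniteType γ t) {p : ℝ[X]} (hp : p.Monic) (hd : 1 ≤ p.natDegree) (r : ℕ) :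
    ∃ (A : ℝ) (B : ℕ), 0 < A ∧ ∀ (K M a : ℕ) (b : ℝ), a ≠ 0 → a ≤ K → A * K ^ B ≤ M →
      ∀ h : Fin s → ℤ, h ≠ 0 → (∀ i, |h i| ≤ K) →
      ‖∑ m ∈ range M, (𝐞 (∑ i, h i * (γ i * p.eval (a * (m : ℝ) + b))) : ℂ)‖
        ≤ 6 * M / (K : ℝ) ^ r := by
  obtain ⟨c, T, hc, h_irr⟩ := hγ.exists_isIrrationalUpTo
  obtain ⟨d, hd⟩ : ∃ d, p.natDegree = d + 1 := Nat.exists_eq_add_of_le' hd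
  set F := ((d + 1).factorial : ℝ)
  have hF : 1 ≤ F := Nat.one_le_cast.2 (Nat.factorial_pos _)
  set u := r * 2 ^ d
  set e := u * d + (d + 1) + 1
  refine ⟨c * F ^ T + 1, e * T + 2 * u, by positivity, fun K M a b ha haK hKM h hh hhK => ?_⟩
  have hK : 0 < K := (Nat.pos_of_ne_zero ha).trans_le haK
  have hK₁ : (1 : ℝ) ≤ K := by exact_mod_cast hK
  set H := (K ^ r) ^ 2 ^ d
  have hH : (H : ℝ) = K ^ u := by simp only [H, u, pow_mul, Nat.cast_pow]
  have hQ : 1 ≤ F * H ^ d * K ^ (d + 1) := by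
    rw [hH]
    exact one_le_mul_of_one_le_of_one_le
      (one_le_mul_of_one_le_of_one_le hF (one_le_pow₀ (one_le_pow₀ hK₁))) (one_le_pow₀ hK₁)
  have h_factor : ∀ m : ℕ, ∑ i, h i * (γ i * p.eval (a * (m : ℝ) + b))
      = (∑ i, h i * γ i) * p.eval (a * (m : ℝ) + b) := by
    intro m
    simp only [sum_mul, mul_assoc]
  simp_rw [h_factor, ← Nat.cast_pow]
  refine norm_sum_fourierChar_mul_eval_progression_le hp hd (pow_pos hK r) rfl ?_ ?_ ha
    (P := (K : ℝ) ^ (d + 1)) (by gcongr)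
    (h_irr _ K h hQ hK₁ hh fun i => by exact_mod_cast hhK i)
  · calc (H : ℝ) ^ 2 = 1 * (K : ℝ) ^ (2 * u) := by rw [hH, ← pow_mul, mul_comm u, one_mul]
      _ ≤ (c * F ^ T + 1) * K ^ (e * T + 2 * u) := by
        gcongr
        · exact le_add_of_nonneg_left (by positivity)
        · omega
      _ ≤ M := hKM
  · calc c * (F * H ^ d * K ^ (d + 1) * K) ^ T * H = c * F ^ T * K ^ (e * T + u) := by
          rw [hH]
          ring
      _ ≤ (c * F ^ T + 1) * K ^ (e * T + 2 * u) := by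
        gcongr
        · exact le_add_of_nonneg_right zero_le_one
        · omega
      _ ≤ M := hKM

/-! ### Sums along progressions and the well-distribution measure -/

theorem progressionSum_eq_sum_range (e : ℤ → ℤ) (M a : ℕ) (b : ℤ) :
    progressionSum e M a b = ∑ m ∈ range M, e (a * m + (a + b)) := by
  rw [progressionSum, ← Ico_add_one_right_eq_Icc, sum_Ico_eq_sum_range, Nat.add_sub_cancel]
  refine sum_congr rfl fun m _ => congrArg e ?_
  push_cast
  ring

theorem abs_progressionSum_le {e : ℤ → ℤ} (he : ∀ n, |e n| ≤ 1) (M a : ℕ) (b : ℤ) :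
    |(progressionSum e M a b : ℝ)| ≤ M := by
  have h_terms : |progressionSum e M a b| ≤ ∑ _m ∈ Icc 1 M, 1 :=
    (abs_sum_le_sum_abs _ _).trans (sum_le_sum fun m _ => he _)
  rw [sum_const, Nat.card_Icc, Nat.add_sub_cancel, nsmul_one] at h_terms
  exact_mod_cast h_terms

theorem IsOfFiniteType.exists_abs_progressionSum_genPoly_le {α₁ α₂ β t : ℝ}
    (hγ : IsOfFiniteType ![α₂, α₁ * α₂, α₁ * α₂ * β] t) {p : ℝ[X]} (hp : p.Monic)
    (hd : 1 ≤ p.natDegree) :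
    ∃ (A C : ℝ) (B : ℕ), 0 < A ∧ 0 < C ∧ ∀ (J M a : ℕ) (b : ℤ), a ≠ 0 → a ≤ J →
      A * J ^ B ≤ M →
      |(progressionSum (inducedSeq (genPoly α₁ α₂ β p)) M a b : ℝ)| ≤ C * (M / J) := by
  obtain ⟨A, B, hA, h_exp⟩ := hγ.exists_norm_sum_fourierChar_le hp hd 4
  refine ⟨A * 2 ^ B, 34 + 112 * (1 + |α₁| + |β|), 3 * B, by positivity, by positivity,
    fun J M a b ha haJ hJM => ?_⟩
  have hJ : 0 < J := (Nat.pos_of_ne_zero ha).trans_le haJ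
  have haK : a ≤ 2 * J ^ 3 := by
    have hJ_pow : J ≤ J ^ 3 := Nat.le_self_pow (by norm_num) J
    omega
  have hKM : A * ((2 * J ^ 3 : ℕ) : ℝ) ^ B ≤ M := by
    push_cast
    rwa [mul_pow, ← pow_mul, ← mul_assoc]
  have h_sum : (progressionSum (inducedSeq (genPoly α₁ α₂ β p)) M a b : ℝ)
      = ∑ m ∈ range M, (torusSign α₁ β (fun i => ![α₂, α₁ * α₂, α₁ * α₂ * β] i
          * p.eval (a * (m : ℝ) + (a + b))) : ℝ) := by
    rw [progressionSum_eq_sum_range, Int.cast_sum]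
    simp_rw [inducedSeq_genPoly]
    push_cast
    rfl
  have h_bound := abs_sum_torusSign_le (α₁ := α₁) (β := β) hJ rfl (S := range M)
    (x := fun m i => ![α₂, α₁ * α₂, α₁ * α₂ * β] i * p.eval (a * (m : ℝ) + (a + b)))
    (by simpa only [card_range] using h_exp (2 * J ^ 3) M a (a + b) ha haK hKM)
  rwa [card_range, ← h_sum] at h_bound

theorem le_and_mul_le_two_mul_of_progression {N M a : ℕ} {b : ℤ} (ha : 1 ≤ a)
    (h_first : 1 ≤ (a : ℤ) + b) (h_lt : (a : ℤ) + b < a * M + b) (h_last : (a : ℤ) * M + b ≤ N) :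
    M ≤ N ∧ a * M ≤ 2 * N := by
  have hM : 2 ≤ M := by
    by_contra! hM
    interval_cases M <;> push_cast at h_lt <;> omega
  constructor <;> zify at * <;> nlinarith

section WellDistribution

variable {e : ℤ → ℤ} {A C : ℝ} {B N : ℕ}

theorem abs_progressionSum_le_mul_pow (he : ∀ n, |e n| ≤ 1) (hA : 0 ≤ A) (hC : 0 ≤ C)
    (h : ∀ (J M a : ℕ) (b : ℤ), a ≠ 0 → a ≤ J → A * J ^ B ≤ M →
      |(progressionSum e M a b : ℝ)| ≤ C * (M / J))
    {y : ℝ} (hy : 1 ≤ y) (hyN : y ^ (B + 1) = N) {M a : ℕ} {b : ℤ} (ha : a ≠ 0) (hMN : M ≤ N)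
    (haM : a * M ≤ 2 * N) :
    |(progressionSum e M a b : ℝ)| ≤ (A * 2 ^ B + 2 + C) * y ^ B := by
  have hy₀ : 0 < y := by linarith
  have h_trivial := abs_progressionSum_le he M a b
  have h_le_ceil : y ≤ ⌈y⌉₊ := Nat.le_ceil y
  have h_ceil_le : (⌈y⌉₊ : ℝ) ≤ 2 * y := by linarith [Nat.ceil_lt_add_one hy₀.le]
  have h_short : 0 ≤ A * 2 ^ B * y ^ B := by positivity
  have h_sparse : 0 ≤ C * y ^ B := by positivity
  rcases lt_or_ge (M : ℝ) (A * (⌈y⌉₊ : ℝ) ^ B) with hM_short | hM_long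
  · have h_short_le : A * (⌈y⌉₊ : ℝ) ^ B ≤ A * 2 ^ B * y ^ B := by
      rw [mul_assoc, ← mul_pow]
      gcongr
    linarith [pow_pos hy₀ B]
  rcases lt_or_ge ⌈y⌉₊ a with ha_large | ha_small
  · have h_ya : y ≤ a := h_le_ceil.trans (by exact_mod_cast ha_large.le)
    have h_yM : y * M ≤ y * (2 * y ^ B) :=
      calc y * M ≤ a * M := by gcongr
        _ ≤ 2 * N := by exact_mod_cast haM
        _ = y * (2 * y ^ B) := by rw [← hyN]; ring
    linarith [le_of_mul_le_mul_left h_yM hy₀]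
  · have h_quot : (M : ℝ) / ⌈y⌉₊ ≤ y ^ B :=
      calc (M : ℝ) / ⌈y⌉₊ ≤ N / y := by gcongr
        _ = y ^ B := by rw [← hyN, pow_succ, mul_div_cancel_right₀ _ hy₀.ne']
    linarith [h _ M a b ha ha_small hM_long, mul_le_mul_of_nonneg_left h_quot hC, pow_pos hy₀ B]

theorem wellDistribution_le (he : ∀ n, |e n| ≤ 1) (hA : 0 ≤ A) (hC : 0 ≤ C)
    (h : ∀ (J M a : ℕ) (b : ℤ), a ≠ 0 → a ≤ J → A * J ^ B ≤ M →
      |(progressionSum e M a b : ℝ)| ≤ C * (M / J)) (hN : 1 ≤ N) :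
    wellDistribution e N ≤ (A * 2 ^ B + 2 + C) * (N : ℝ) ^ (1 - 1 / (B + 1) : ℝ) := by
  set y : ℝ := (N : ℝ) ^ (1 / (B + 1) : ℝ)
  have hy : 1 ≤ y := Real.one_le_rpow (by exact_mod_cast hN) (by positivity)
  have hyN : y ^ (B + 1) = N := by
    rw [← Real.rpow_mul_natCast (Nat.cast_nonneg N)]
    push_cast
    rw [one_div_mul_cancel (by positivity), Real.rpow_one]
  have hy_pow : (N : ℝ) ^ (1 - 1 / (B + 1) : ℝ) = y ^ B := by
    rw [← Real.rpow_mul_natCast (Nat.cast_nonneg N)]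
    congr 1
    field_simp
    ring
  rw [hy_pow]
  refine Real.sSup_le ?_ (by positivity)
  rintro x ⟨a, b, M, ha, -, h_first, h_lt, h_last, rfl⟩
  obtain ⟨hMN, haM⟩ := le_and_mul_le_two_mul_of_progression ha h_first h_lt h_last
  exact abs_progressionSum_le_mul_pow he hA hC h hy hyN (Nat.ne_of_gt ha) hMN haM

end WellDistribution

theorem theorem1_general (α₁ α₂ β : ℝ) (p : ℝ[X]) (hp : p.Monic) (hd : 1 ≤ p.natDegree) (t : ℝ)
    (htype : IsOfFiniteType ![α₂, α₁ * α₂, α₁ * α₂ * β] t) :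
    ∃ η : ℝ, 0 < η ∧ ∃ C : ℝ, 0 < C ∧ ∀ N : ℕ, 1 ≤ N →
      wellDistribution (inducedSeq (genPoly α₁ α₂ β p)) N ≤ C * (N : ℝ) ^ (1 - η) := by
  obtain ⟨A, C, B, hA, hC, h_sum⟩ := htype.exists_abs_progressionSum_genPoly_le hp hd
  exact ⟨1 / (B + 1), by positivity, A * 2 ^ B + 2 + C, by positivity, fun N hN =>
    wellDistribution_le (fun n => (abs_chiSign _).le) hA.le hC.le h_sum hN⟩

theorem theorem1 (α₁ α₂ β : ℝ) (p : Polynomial ℝ) (hp : p.Monic) (hd : 2 ≤ p.natDegree)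
    (t : ℝ) (ht : 0 < t)
    (htype : IsOfFiniteType ![α₂, α₁ * α₂, α₁ * α₂ * β] t) :
    ∃ η : ℝ, 0 < η ∧ ∀ ε : ℝ, 0 < ε → ∃ C : ℝ, 0 < C ∧ ∀ N : ℕ, 1 ≤ N →
      wellDistribution (inducedSeq (genPoly α₁ α₂ β p)) N ≤ C * (N : ℝ) ^ (1 - η + ε) := by
  obtain ⟨η, hη, C, hC, h⟩ := theorem1_general α₁ α₂ β p hp (one_le_two.trans hd) t htype
  exact ⟨η, hη, fun ε hε => ⟨C, hC, fun N hN => (h N hN).trans <| mul_le_mul_of_nonneg_left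
    (Real.rpow_le_rpow_of_exponent_le (by exact_mod_cast hN) (by linarith)) hC.le⟩⟩
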